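/- Let $(N,h)$ be a smooth $n$-dimensional Riemannian manifold ($n\ge 1$) with Levi-Civita connection $\nabla$ and Riemann curvature tensor $R$, and let $\gamma:\mathbb R\to N$ be a geodesic parametrized by arc-length. Suppose that $N$ is locally symmetric along $\gamma$, i.e. $\nabla_{\dot\gamma}\nabla^jR|_\gamma=0$ for all $j\ge 0$. Let $e_1=\dot\gamma$, and let $e_2,\dots,e_n$ be parallel vector fields along $\gamma$ such that $(e_1,\dots,e_n)$ is orthonormal at $\gamma(0)$. The geodesic normal coordinates $(x^1,\dots,x^n)=(x^1,\hat x)$ around $\gamma$ are given by the smooth parametrization $$\sigma(x^1,\hat x)=\exp_{\gamma(x^1)}\Big(\sum_{j=2}^n x^je_j(x^1)\Big),$$ defined on a neighbourhood of the axis $\{\hat x=0\}$ in $\mathbb R^n$, the axis corresponding to $\gamma$. Let $\partial_i=\partial/\partial x^i$, and let $\Gamma^i_{jk}$ be the Christoffel symbols of $h$ in these coordinates, i.e. those of the metric components $h(\partial_i\sigma,\partial_j\sigma)$. Then the functions $\Gamma^i_{jk}$ are smooth near the axis, and for all $q\ge 0$ and all $i,j,k\in\{1,\dots,n\}$, $$\partial_1^q\partial_1\partial_j\Gamma^i_{1k}\big|_\gamma=\partial_1^q\partial_1\Gamma^i_{1k}\big|_\gamma=0,$$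 $$\partial_1^q\partial_j\partial_k\Gamma^1_{11}\big|_\gamma=\partial_1^q\partial_k\Gamma^1_{11}\big|_\gamma=\partial_1^q\Gamma^1_{11}\big|_\gamma=0 .$$ -/

import Mathlib

open scoped Manifold ContDiff Topology

noncomputable section

namespace GeodesicCoords

/-! The space of coordinates is `EuclideanSpace ℝ (Fin n)`. Indices run over `Fin n`; the index `0`
is the distinguished first coordinate `x¹`, the indices `≠ 0` are the transversal ones. -/

/-- The partial derivative `∂ᵢ f`. -/
def pd {n : ℕ} (i : Fin n) (f : EuclideanSpace ℝ (Fin n) → ℝ) (x : EuclideanSpace ℝ (Fin n)) : ℝ :=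
  fderiv ℝ f x (EuclideanSpace.single i 1)

/-! ### Local Riemannian geometry of a matrix-valued function of the coordinates -/

/-- The Christoffel symbol `Γⁱⱼₖ` of the metric with components `G`. -/
def christoffel {n : ℕ} (G : EuclideanSpace ℝ (Fin n) → Matrix (Fin n) (Fin n) ℝ) (i j k : Fin n)
    (x : EuclideanSpace ℝ (Fin n)) : ℝ :=
  (1 / 2 : ℝ) * ∑ l, (G x)⁻¹ i l *
    (pd j (fun y => G y k l) x + pd k (fun y => G y j l) x - pd l (fun y => G y j k) x)

/-- The components `Rⁱⱼₖₗ` of the Riemann curvature tensor, in the convention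
`(∇ⱼ∇ₖ - ∇ₖ∇ⱼ) ∂ₗ = Rⁱⱼₖₗ ∂ᵢ`; the lower indices `j, k, l` are `a 0, a 1, a 2`. -/
def riemann {n : ℕ} (G : EuclideanSpace ℝ (Fin n) → Matrix (Fin n) (Fin n) ℝ)
    (x : EuclideanSpace ℝ (Fin n)) (a : Fin 3 → Fin n) (i : Fin n) : ℝ :=
  pd (a 0) (christoffel G i (a 1) (a 2)) x - pd (a 1) (christoffel G i (a 0) (a 2)) x
    + ∑ m, (christoffel G i (a 0) m x * christoffel G m (a 1) (a 2) x
      - christoffel G i (a 1) m x * christoffel G m (a 0) (a 2) x)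

/-- The components of the covariant derivative of a tensor field `T` with `m` lower indices and one
upper index. The new lower index, the direction of differentiation, is put first:
`(∇T)ⁱ_{b a₀ … aₘ₋₁} = ∂_b Tⁱ_{a₀ …} + Γⁱ_{b p} Tᵖ_{a₀ …} - ∑ₛ Γᵖ_{b aₛ} Tⁱ_{a₀ … p … aₘ₋₁}`. -/
def covDeriv {n m : ℕ} (G : EuclideanSpace ℝ (Fin n) → Matrix (Fin n) (Fin n) ℝ)
    (T : EuclideanSpace ℝ (Fin n) → (Fin m → Fin n) → Fin n → ℝ)
    (x : EuclideanSpace ℝ (Fin n)) (a : Fin (m + 1) → Fin n) (i : Fin n) : ℝ :=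
  pd (a 0) (fun y => T y (Fin.tail a) i) x
    + ∑ p, christoffel G i (a 0) p x * T x (Fin.tail a) p
    - ∑ s, ∑ p, christoffel G p (a 0) (Fin.tail a s) x * T x (Function.update (Fin.tail a) s p) i

/-- The components of the `j`-th covariant derivative `∇ʲR` of the curvature tensor. -/
def nablaR {n : ℕ} (G : EuclideanSpace ℝ (Fin n) → Matrix (Fin n) (Fin n) ℝ) :
    (j : ℕ) → EuclideanSpace ℝ (Fin n) → (Fin (3 + j) → Fin n) → Fin n → ℝ
  | 0 => riemann G
  | j + 1 => covDeriv G (nablaR G j)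

/-! ### Riemannian manifolds -/

variable {n : ℕ} {N : Type*} [TopologicalSpace N] [ChartedSpace (EuclideanSpace ℝ (Fin n)) N]
  [IsManifold (𝓡 n) ∞ N]

/-- A smooth Riemannian metric on the manifold `N`. -/
abbrev Metric (n : ℕ) (N : Type*) [TopologicalSpace N]
    [ChartedSpace (EuclideanSpace ℝ (Fin n)) N] [IsManifold (𝓡 n) ∞ N] :=
  Bundle.ContMDiffRiemannianMetric (𝓡 n) ∞ (EuclideanSpace ℝ (Fin n))
    (fun p : N => TangentSpace (𝓡 n) p)

/-- The components `h(∂ᵢφ, ∂ⱼφ)` of the metric in the parametrization `φ`. -/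
def metricComp (h : Metric n N) (φ : EuclideanSpace ℝ (Fin n) → N)
    (x : EuclideanSpace ℝ (Fin n)) : Matrix (Fin n) (Fin n) ℝ :=
  Matrix.of fun i j => h.inner (φ x)
    (mfderiv 𝓘(ℝ, EuclideanSpace ℝ (Fin n)) (𝓡 n) φ x (EuclideanSpace.single i (1 : ℝ)))
    (mfderiv 𝓘(ℝ, EuclideanSpace ℝ (Fin n)) (𝓡 n) φ x (EuclideanSpace.single j (1 : ℝ)))

/-- The components of a tangent vector in the chart `χ`. -/
def vecComp (χ : OpenPartialHomeomorph N (EuclideanSpace ℝ (Fin n))) (p : N)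
    (v : TangentSpace (𝓡 n) p) (i : Fin n) : ℝ :=
  (show EuclideanSpace ℝ (Fin n) from mfderiv (𝓡 n) 𝓘(ℝ, EuclideanSpace ℝ (Fin n)) χ p v) i

/-- The velocity of a curve. -/
def velocity (c : ℝ → N) (t : ℝ) : TangentSpace (𝓡 n) (c t) :=
  mfderiv 𝓘(ℝ, ℝ) (𝓡 n) c t (1 : ℝ)

/-- The vector field `V` along the curve `c` is parallel on the set `J` of parameters: in every
chart of the smooth structure, `(Vᵏ)' + Γᵏᵢⱼ ċⁱ Vʲ = 0`. -/
def IsParallelOn (h : Metric n N) (c : ℝ → N) (V : (t : ℝ) → TangentSpace (𝓡 n) (c t))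
    (J : Set ℝ) : Prop :=
  ∀ t ∈ J, ∀ χ ∈ IsManifold.maximalAtlas (𝓡 n) ∞ N, c t ∈ χ.source → ∀ k : Fin n,
    HasDerivAt (fun s => vecComp χ (c s) (V s) k)
      (-∑ i, ∑ j, christoffel (metricComp h χ.symm) k i j (χ (c t)) *
        vecComp χ (c t) (velocity c t) i * vecComp χ (c t) (V t) j) t

/-- The curve `c` is a geodesic (smooth, with parallel velocity) on the open set `J` of
parameters. -/
def IsGeodesicOn (h : Metric n N) (c : ℝ → N) (J : Set ℝ) : Prop :=
  ContMDiffOn 𝓘(ℝ, ℝ) (𝓡 n) ∞ c J ∧ IsParallelOn h c (velocity c) J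

/-- `(N, h)` is locally symmetric along `γ`: the tensors `∇_{γ̇} ∇ʲR`, for all `j ≥ 0`, vanish at the
points of `γ`, that is, their components `γ̇ᵇ (∇ʲ⁺¹R)ⁱ_{b a₀ a₁ …}` in the charts of the smooth
structure do. -/
def IsLocallySymmetricAlong (h : Metric n N) (γ : ℝ → N) : Prop :=
  ∀ (j : ℕ) (t : ℝ), ∀ χ ∈ IsManifold.maximalAtlas (𝓡 n) ∞ N, γ t ∈ χ.source →
    ∀ (a : Fin (3 + j) → Fin n) (i : Fin n),
      ∑ b, vecComp χ (γ t) (velocity γ t) b *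
        nablaR (metricComp h χ.symm) (j + 1) (χ (γ t))
          (Fin.cons (α := fun _ : Fin (3 + j + 1) => Fin n) b a) i = 0

/-! ### Geodesic normal coordinates along a geodesic -/

/-- The point `(t, 0, …, 0)`; it corresponds to `γ(t)`. -/
def axis [NeZero n] (t : ℝ) : EuclideanSpace ℝ (Fin n) := EuclideanSpace.single 0 t

/-- The point `(x¹, s x², …, s xⁿ)`. -/
def scaleTransversal [NeZero n] (s : ℝ) (x : EuclideanSpace ℝ (Fin n)) :
    EuclideanSpace ℝ (Fin n) :=
  WithLp.toLp 2 fun i => if i = 0 then x i else s * x i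

/-- `e` is an orthonormal frame along `γ` with first vector `γ̇` (in particular `γ` is parametrized by
arc-length), orthonormal at `γ(0)` and transported along `γ` by parallel transport. -/
structure IsParallelFrame [NeZero n] (h : Metric n N) (γ : ℝ → N)
    (e : Fin n → (t : ℝ) → TangentSpace (𝓡 n) (γ t)) : Prop where
  first : ∀ t, e 0 t = velocity γ t
  orthonormal : ∀ i j, h.inner (γ 0) (e i 0) (e j 0) = if i = j then 1 else 0
  parallel : ∀ i, IsParallelOn h γ (e i) Set.univ

/-- `σ`, on a neighbourhood `U` of the axis, is the smooth parametrization
`σ(x¹, x̂) = exp_{γ(x¹)} (∑_{j ≥ 2} xʲ eⱼ(x¹))` by geodesic normal coordinates around `γ`: for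
`x ∈ U`, the curve `s ↦ σ(x¹, s x̂)` is the geodesic which starts at `s = 0` from `γ(x¹)` with the
velocity `∑_{j ≥ 2} xʲ eⱼ(x¹)`. (At the points of the axis the differential of `σ` maps the
standard basis to `e`, so `σ` is a local diffeomorphism there.) -/
structure IsGeodesicNormalCoordinates [NeZero n] (h : Metric n N) (γ : ℝ → N)
    (e : Fin n → (t : ℝ) → TangentSpace (𝓡 n) (γ t))
    (U : Set (EuclideanSpace ℝ (Fin n))) (σ : EuclideanSpace ℝ (Fin n) → N) : Prop where
  isOpen : IsOpen U
  axis_mem : ∀ t : ℝ, axis t ∈ U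
  star : ∀ x ∈ U, ∀ s ∈ Set.Icc (0 : ℝ) 1, scaleTransversal s x ∈ U
  smooth : ContMDiffOn 𝓘(ℝ, EuclideanSpace ℝ (Fin n)) (𝓡 n) ∞ σ U
  geodesic : ∀ x ∈ U, IsGeodesicOn h (fun s : ℝ => σ (scaleTransversal s x))
    {s : ℝ | scaleTransversal s x ∈ U}
  initial : ∀ x ∈ U,
    (⟨σ (scaleTransversal 0 x), velocity (fun s : ℝ => σ (scaleTransversal s x)) 0⟩ :
      TangentBundle (𝓡 n) N) =
    ⟨γ (x 0), ∑ j ∈ Finset.univ.filter (· ≠ (0 : Fin n)), x j • e j (x 0)⟩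

end GeodesicCoords

end

/-!
Let `G` be the matrix of the metric in the coordinates `σ`. On the axis `G = 1`, because the
differential of `σ` maps the standard basis to the parallel orthonormal frame `e`, and all
Christoffel symbols vanish there: `Γⁱ₀ₖ = 0` since the frame is parallel along the axis, and
`Γⁱⱼₖ = 0` for transversal `j`, `k` by polarization, since the transversal lines through a point of
the axis are geodesics with constant coordinate velocity. At a point where `G = 1` and `Γ = 0` the
quadratic terms of the curvature do not contribute to `∇R`, so `∇_γ̇ R = 0` reads
`∂₀∂ⱼΓⁱ₀ₖ = ∂₀∂₀Γⁱⱼₖ`, and the right-hand side is a derivative along the axis of a function which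
vanishes there.

For `Γ⁰₀₀`, lowering the upper index changes neither the first nor the second derivatives at such a
point (the terms which involve a derivative of `G` vanish), and `[00, 0] = ½ ∂₀G₀₀` and
`[0k, 0] = ½ ∂ₖG₀₀` have `∂ₖ[00, 0] = ∂₀[0k, 0]`. This turns `∂ₖΓ⁰₀₀` and `∂ⱼ∂ₖΓ⁰₀₀` into `∂₀Γ⁰₀ₖ`
and `∂₀∂ⱼΓ⁰₀ₖ`.
-/

namespace GeodesicCoords

open scoped Matrix

section PartialDerivatives

variable {n : ℕ} {f g : EuclideanSpace ℝ (Fin n) → ℝ} {x : EuclideanSpace ℝ (Fin n)}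

lemma fderiv_apply_eq_sum_pd (f : EuclideanSpace ℝ (Fin n) → ℝ)
    (x v : EuclideanSpace ℝ (Fin n)) : fderiv ℝ f x v = ∑ i, v i * pd i f x := by
  have hv : v = ∑ i, v i • EuclideanSpace.single i (1 : ℝ) := by
    simpa using ((EuclideanSpace.basisFun (Fin n) ℝ).sum_repr v).symm
  conv_lhs => rw [hv]
  simp [pd]

lemma pd_eventuallyEq (h : f =ᶠ[𝓝 x] g) (i : Fin n) : pd i f =ᶠ[𝓝 x] pd i g :=
  (h.fderiv (𝕜 := ℝ)).mono fun _ hy => by simp only [pd, hy]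

lemma pd_congr (h : f =ᶠ[𝓝 x] g) (i : Fin n) : pd i f x = pd i g x :=
  (pd_eventuallyEq h i).self_of_nhds

lemma contDiffAt_pd {k m : WithTop ℕ∞} (hf : ContDiffAt ℝ k f x) (hmk : m + 1 ≤ k) (i : Fin n) :
    ContDiffAt ℝ m (pd i f) x :=
  (hf.fderiv_right hmk).clm_apply contDiffAt_const

lemma pd_add (hf : DifferentiableAt ℝ f x) (hg : DifferentiableAt ℝ g x) (i : Fin n) :
    pd i (fun y => f y + g y) x = pd i f x + pd i g x := by
  simp only [pd, fderiv_fun_add hf hg, add_apply]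

lemma pd_sub (hf : DifferentiableAt ℝ f x) (hg : DifferentiableAt ℝ g x) (i : Fin n) :
    pd i (fun y => f y - g y) x = pd i f x - pd i g x := by
  simp only [pd, fderiv_fun_sub hf hg, sub_apply]

lemma pd_const_mul (hf : DifferentiableAt ℝ f x) (c : ℝ) (i : Fin n) :
    pd i (fun y => c * f y) x = c * pd i f x := by
  simp only [pd, fderiv_const_mul hf, smul_apply, smul_eq_mul]

lemma pd_mul (hf : DifferentiableAt ℝ f x) (hg : DifferentiableAt ℝ g x) (i : Fin n) :
    pd i (fun y => f y * g y) x = f x * pd i g x + pd i f x * g x := by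
  simp only [pd, fderiv_fun_mul hf hg, add_apply, smul_apply, smul_eq_mul]
  ring

lemma pd_sum {ι : Type*} {s : Finset ι} {F : ι → EuclideanSpace ℝ (Fin n) → ℝ}
    (hF : ∀ m ∈ s, DifferentiableAt ℝ (F m) x) (i : Fin n) :
    pd i (fun y => ∑ m ∈ s, F m y) x = ∑ m ∈ s, pd i (F m) x := by
  simp only [pd, fderiv_fun_sum hF, sum_apply]

lemma pd_comm (hf : ContDiffAt ℝ 2 f x) (i j : Fin n) : pd i (pd j f) x = pd j (pd i f) x := by
  have hd : DifferentiableAt ℝ (fderiv ℝ f) x :=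
    (hf.fderiv_right (m := 1) (by norm_num)).differentiableAt (by simp)
  have pd_pd_eq (a b : Fin n) : pd a (pd b f) x
      = fderiv ℝ (fderiv ℝ f) x (EuclideanSpace.single a 1) (EuclideanSpace.single b 1) := by
    unfold pd
    rw [fderiv_clm_apply hd (differentiableAt_const _)]
    simp
  rw [pd_pd_eq, pd_pd_eq, hf.isSymmSndFDerivAt (by simp)]

lemma eventually_differentiableAt (hf : ContDiffAt ℝ 1 f x) :
    ∀ᶠ y in 𝓝 x, DifferentiableAt ℝ f y :=
  (hf.eventually (by simp)).mono fun _ hy => hy.differentiableAt (by simp)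

lemma pd_pd_mul (hf : ContDiffAt ℝ 2 f x) (hg : ContDiffAt ℝ 2 g x) (i j : Fin n) :
    pd i (pd j fun y => f y * g y) x = f x * pd i (pd j g) x + pd i f x * pd j g x
      + pd j f x * pd i g x + pd i (pd j f) x * g x := by
  have hf1 : ContDiffAt ℝ 1 f x := hf.of_le (by norm_num)
  have hg1 : ContDiffAt ℝ 1 g x := hg.of_le (by norm_num)
  have leibniz : pd j (fun y => f y * g y) =ᶠ[𝓝 x] fun y => f y * pd j g y + pd j f y * g y := by
    filter_upwards [eventually_differentiableAt hf1, eventually_differentiableAt hg1]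
      with y hfy hgy using pd_mul hfy hgy j
  have hfd := hf1.differentiableAt one_ne_zero
  have hgd := hg1.differentiableAt one_ne_zero
  have hfd' : DifferentiableAt ℝ (pd j f) x :=
    (contDiffAt_pd (m := 1) hf (by norm_num) j).differentiableAt one_ne_zero
  have hgd' : DifferentiableAt ℝ (pd j g) x :=
    (contDiffAt_pd (m := 1) hg (by norm_num) j).differentiableAt one_ne_zero
  rw [pd_congr leibniz, pd_add (hfd.fun_mul hgd') (hfd'.fun_mul hgd), pd_mul hfd hgd',
    pd_mul hfd' hgd]
  ring

lemma pd_pd_sum {ι : Type*} {s : Finset ι} {F : ι → EuclideanSpace ℝ (Fin n) → ℝ}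
    (hF : ∀ m ∈ s, ContDiffAt ℝ 2 (F m) x) (i j : Fin n) :
    pd i (pd j fun y => ∑ m ∈ s, F m y) x = ∑ m ∈ s, pd i (pd j (F m)) x := by
  have pd_sum_near : pd j (fun y => ∑ m ∈ s, F m y) =ᶠ[𝓝 x] fun y => ∑ m ∈ s, pd j (F m) y := by
    filter_upwards [(Filter.eventually_all_finset s).2 fun m hm =>
      eventually_differentiableAt ((hF m hm).of_le (by norm_num))] with y hy using pd_sum hy j
  rw [pd_congr pd_sum_near, pd_sum fun m hm =>
    (contDiffAt_pd (m := 1) (hF m hm) (by norm_num) j).differentiableAt one_ne_zero]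

variable [NeZero n]

lemma hasDerivAt_axis (t : ℝ) : HasDerivAt (axis (n := n)) (EuclideanSpace.single 0 1) t := by
  have axis_eq : axis (n := n) = fun s : ℝ => s • EuclideanSpace.single 0 (1 : ℝ) := by
    funext s
    ext i
    simp [axis]
  rw [axis_eq]
  simpa using (hasDerivAt_id t).smul_const (EuclideanSpace.single (0 : Fin n) (1 : ℝ))

lemma pd_zero_axis_eq_zero (hf : ∀ s, f (axis s) = 0) {t : ℝ}
    (hd : DifferentiableAt ℝ f (axis t)) : pd 0 f (axis t) = 0 := by
  have h := hd.hasFDerivAt.comp_hasDerivAt t (hasDerivAt_axis t)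
  rw [show f ∘ axis = fun _ => (0 : ℝ) from funext hf] at h
  exact h.unique (hasDerivAt_const t 0)

lemma iterate_pd_zero_axis_eq_zero (hf : ∀ s, f (axis s) = 0)
    (hs : ∀ s, ContDiffAt ℝ ∞ f (axis s)) (q : ℕ) (t : ℝ) : (pd 0)^[q] f (axis t) = 0 := by
  induction q generalizing f t with
  | zero => exact hf t
  | succ _ ih =>
    exact ih (fun s => pd_zero_axis_eq_zero hf ((hs s).differentiableAt (by simp)))
      (fun s => contDiffAt_pd (hs s) (by simp) 0) t

end PartialDerivatives

section MatrixSmoothness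

variable {𝕜 E ι : Type*} [NontriviallyNormedField 𝕜] [NormedAddCommGroup E] [NormedSpace 𝕜 E]
  [Fintype ι] [DecidableEq ι] {k : WithTop ℕ∞} {A : E → Matrix ι ι 𝕜} {x : E}

lemma contDiffAt_det (hA : ∀ i j, ContDiffAt 𝕜 k (fun y => A y i j) x) :
    ContDiffAt 𝕜 k (fun y => (A y).det) x := by
  simp only [Matrix.det_apply']
  exact ContDiffAt.sum fun τ _ => contDiffAt_const.mul (contDiffAt_prod fun i _ => hA _ _)

lemma contDiffAt_nonsing_inv (hA : ∀ i j, ContDiffAt 𝕜 k (fun y => A y i j) x)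
    (hdet : IsUnit (A x).det) (i j : ι) : ContDiffAt 𝕜 k (fun y => (A y)⁻¹ i j) x := by
  simp only [Matrix.inv_def, Ring.inverse_eq_inv', Matrix.smul_apply, smul_eq_mul,
    Matrix.adjugate_apply]
  refine ((contDiffAt_det hA).inv hdet.ne_zero).mul (contDiffAt_det fun a b => ?_)
  simp only [Matrix.updateRow_apply]
  split_ifs
  · exact contDiffAt_const
  · exact hA a b

end MatrixSmoothness

section Christoffel

variable {n : ℕ} {G G' : EuclideanSpace ℝ (Fin n) → Matrix (Fin n) (Fin n) ℝ}
  {x : EuclideanSpace ℝ (Fin n)}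

lemma christoffel_eventuallyEq (h : G =ᶠ[𝓝 x] G') (i j k : Fin n) :
    christoffel G i j k =ᶠ[𝓝 x] christoffel G' i j k := by
  filter_upwards [h.eventuallyEq_nhds] with y hy
  have entry (a b : Fin n) : (fun z => G z a b) =ᶠ[𝓝 y] fun z => G' z a b :=
    hy.mono fun z hz => by simp only [hz]
  simp only [christoffel, hy.self_of_nhds, pd_congr (entry _ _)]

lemma riemann_eventuallyEq (h : G =ᶠ[𝓝 x] G') (a : Fin 3 → Fin n) (i : Fin n) :
    (fun y => riemann G y a i) =ᶠ[𝓝 x] fun y => riemann G' y a i := by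
  filter_upwards [h.eventuallyEq_nhds] with y hy
  simp only [riemann, pd_congr (christoffel_eventuallyEq hy _ _ _),
    (christoffel_eventuallyEq hy _ _ _).self_of_nhds]

lemma covDeriv_riemann_congr (h : G =ᶠ[𝓝 x] G') (a : Fin 4 → Fin n) (i : Fin n) :
    covDeriv G (riemann G) x a i = covDeriv G' (riemann G') x a i := by
  simp only [covDeriv, pd_congr (riemann_eventuallyEq h _ _),
    (riemann_eventuallyEq h _ _).self_of_nhds, (christoffel_eventuallyEq h _ _ _).self_of_nhds]

/-- The Christoffel symbol of the first kind `[jk, l]` (with `l` lowered from `Γˡⱼₖ`) of the metric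
with components `G`. It is linear in the first derivatives of `G`, whereas `christoffel` involves
the inverse of `G`. -/
noncomputable def christoffelFirst (G : EuclideanSpace ℝ (Fin n) → Matrix (Fin n) (Fin n) ℝ)
    (l j k : Fin n) (x : EuclideanSpace ℝ (Fin n)) : ℝ :=
  (1 / 2 : ℝ) * (pd j (fun y => G y k l) x + pd k (fun y => G y j l) x - pd l (fun y => G y j k) x)

lemma christoffel_eq_inv_mulVec (G : EuclideanSpace ℝ (Fin n) → Matrix (Fin n) (Fin n) ℝ)
    (x : EuclideanSpace ℝ (Fin n)) (j k : Fin n) :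
    (fun i => christoffel G i j k x) = (G x)⁻¹ *ᵥ fun l => christoffelFirst G l j k x := by
  funext i
  simp only [christoffel, christoffelFirst, Matrix.mulVec, dotProduct, Finset.mul_sum]
  exact Finset.sum_congr rfl fun l _ => by ring

lemma sum_mul_christoffel (hdet : IsUnit (G x).det) (l j k : Fin n) :
    ∑ i, G x l i * christoffel G i j k x = christoffelFirst G l j k x := by
  change (G x *ᵥ fun i => christoffel G i j k x) l = _
  rw [christoffel_eq_inv_mulVec, Matrix.mulVec_mulVec, Matrix.mul_nonsing_inv _ hdet,
    Matrix.one_mulVec]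

lemma contDiffAt_christoffel {r m : WithTop ℕ∞}
    (hG : ∀ a b, ContDiffAt ℝ r (fun y => G y a b) x) (hdet : IsUnit (G x).det) (hmr : m + 1 ≤ r)
    (i j k : Fin n) : ContDiffAt ℝ m (christoffel G i j k) x := by
  have hpd (a b c : Fin n) : ContDiffAt ℝ m (pd c fun y => G y a b) x :=
    contDiffAt_pd (hG a b) hmr c
  have hinv (a b : Fin n) : ContDiffAt ℝ m (fun y => (G y)⁻¹ a b) x :=
    contDiffAt_nonsing_inv (fun a b => (hG a b).of_le (le_self_add.trans hmr)) hdet a b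
  exact contDiffAt_const.mul <| ContDiffAt.sum fun l _ =>
    (hinv i l).mul (((hpd k l j).add (hpd j l k)).sub (hpd j k l))

lemma entry_comm (hG : ∀ y, (G y).IsSymm) (a b : Fin n) :
    (fun y => G y a b) = fun y => G y b a :=
  funext fun y => (hG y).apply b a

lemma christoffel_comm (hG : ∀ y, (G y).IsSymm) (i j k : Fin n) :
    christoffel G i j k x = christoffel G i k j x := by
  unfold christoffel
  rw [entry_comm hG j k]
  congr! 3
  ring

lemma pd_entry_eq_christoffelFirst_add (hG : ∀ y, (G y).IsSymm) (c a b : Fin n) :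
    pd c (fun y => G y a b) x = christoffelFirst G a c b x + christoffelFirst G b c a x := by
  unfold christoffelFirst
  rw [entry_comm hG b a, entry_comm hG c a, entry_comm hG c b]
  ring

lemma christoffelFirst_diag (hG : ∀ y, (G y).IsSymm) (l k : Fin n) :
    christoffelFirst G l l k = fun y => (1 / 2 : ℝ) * pd k (fun z => G z l l) y := by
  funext y
  unfold christoffelFirst
  rw [entry_comm hG k l]
  ring

lemma pd_christoffelFirst_diag_comm (hG : ∀ y, (G y).IsSymm) {l : Fin n}
    (hs : ContDiffAt ℝ 2 (fun y => G y l l) x) (j k : Fin n) :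
    pd j (christoffelFirst G l l k) x = pd k (christoffelFirst G l l j) x := by
  have hd (c : Fin n) : DifferentiableAt ℝ (pd c fun y => G y l l) x :=
    (contDiffAt_pd (m := 1) hs (by norm_num) c).differentiableAt one_ne_zero
  rw [christoffelFirst_diag hG, christoffelFirst_diag hG, pd_const_mul (hd k), pd_const_mul (hd j),
    pd_comm hs]

end Christoffel

section Connection

variable {n : ℕ} {G G' : EuclideanSpace ℝ (Fin n) → Matrix (Fin n) (Fin n) ℝ}
  {x v w : EuclideanSpace ℝ (Fin n)}

/-- The matrix `(Γᵏᵢⱼ vⁱ)ₖⱼ` of the Levi-Civita connection in the direction `v`: the equation of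
parallel transport along `c` is `X' = -connection G c c' *ᵥ X`. -/
noncomputable def connection (G : EuclideanSpace ℝ (Fin n) → Matrix (Fin n) (Fin n) ℝ)
    (x v : EuclideanSpace ℝ (Fin n)) : Matrix (Fin n) (Fin n) ℝ :=
  Matrix.of fun k j => ∑ i, christoffel G k i j x * v i

lemma connection_mulVec (v : EuclideanSpace ℝ (Fin n)) (X : Fin n → ℝ) (k : Fin n) :
    (connection G x v *ᵥ X) k = ∑ i, ∑ j, christoffel G k i j x * v i * X j := by
  simp only [connection, Matrix.mulVec, dotProduct, Matrix.of_apply, Finset.sum_mul]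
  exact Finset.sum_comm

lemma connection_congr (h : G =ᶠ[𝓝 x] G') (v : EuclideanSpace ℝ (Fin n)) :
    connection G x v = connection G' x v := by
  ext k j
  simp only [connection, Matrix.of_apply, (christoffel_eventuallyEq h k _ j).self_of_nhds]

lemma connection_add (v w : EuclideanSpace ℝ (Fin n)) :
    connection G x (v + w) = connection G x v + connection G x w := by
  ext k j
  simp [connection, mul_add, Finset.sum_add_distrib]

lemma connection_smul (r : ℝ) (v : EuclideanSpace ℝ (Fin n)) :
    connection G x (r • v) = r • connection G x v := by
  ext k j
  simp [connection, Finset.mul_sum, mul_left_comm]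

lemma connection_mulVec_comm (hG : ∀ y, (G y).IsSymm) (v w : EuclideanSpace ℝ (Fin n)) :
    connection G x v *ᵥ w.ofLp = connection G x w *ᵥ v.ofLp := by
  ext k
  rw [connection_mulVec, connection_mulVec, Finset.sum_comm]
  refine Finset.sum_congr rfl fun j _ => Finset.sum_congr rfl fun i _ => ?_
  rw [christoffel_comm hG, mul_right_comm]

lemma connection_single_mulVec_single (i j k : Fin n) :
    (connection G x (EuclideanSpace.single j 1) *ᵥ (EuclideanSpace.single k (1 : ℝ)).ofLp) i
      = christoffel G i j k x := by
  simp [connection_mulVec, Pi.single_apply]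

lemma connection_mulVec_eq_zero_of_self (hG : ∀ y, (G y).IsSymm)
    (hv : connection G x v *ᵥ v.ofLp = 0) (hw : connection G x w *ᵥ w.ofLp = 0)
    (hvw : connection G x (v + w) *ᵥ (v + w).ofLp = 0) : connection G x v *ᵥ w.ofLp = 0 := by
  rw [connection_add, WithLp.ofLp_add, Matrix.add_mulVec, Matrix.mulVec_add, Matrix.mulVec_add, hv,
    hw, zero_add, add_zero, connection_mulVec_comm hG w v, ← two_smul ℝ] at hvw
  exact (smul_eq_zero.1 hvw).resolve_left two_ne_zero

lemma hasDerivAt_dotProduct_mulVec {ι : Type*} [Fintype ι] {M : ℝ → Matrix ι ι ℝ}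
    {M' : Matrix ι ι ℝ} {X Y : ℝ → ι → ℝ} {X' Y' : ι → ℝ} {t : ℝ}
    (hM : ∀ a b, HasDerivAt (fun s => M s a b) (M' a b) t)
    (hX : HasDerivAt X X' t) (hY : HasDerivAt Y Y' t) :
    HasDerivAt (fun s => X s ⬝ᵥ M s *ᵥ Y s)
      (X' ⬝ᵥ M t *ᵥ Y t + X t ⬝ᵥ M' *ᵥ Y t + X t ⬝ᵥ M t *ᵥ Y') t := by
  rw [hasDerivAt_pi] at hX hY
  refine (HasDerivAt.fun_sum (u := Finset.univ) fun a _ => (hX a).fun_mul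
    (HasDerivAt.fun_sum (u := Finset.univ) fun b _ => (hM a b).fun_mul (hY b))).congr_deriv ?_
  simp only [dotProduct, Matrix.mulVec, ← Finset.sum_add_distrib, ← mul_add, add_assoc]

lemma mul_connection_apply (hdet : IsUnit (G x).det) (v : EuclideanSpace ℝ (Fin n))
    (a b : Fin n) :
    (G x * connection G x v) a b = ∑ i, v i * christoffelFirst G a i b x := by
  simp only [← sum_mul_christoffel hdet, Matrix.mul_apply, connection, Matrix.of_apply,
    Finset.mul_sum]
  rw [Finset.sum_comm]
  exact Finset.sum_congr rfl fun _ _ => Finset.sum_congr rfl fun _ _ => by ring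

lemma fderiv_entry_apply (hG : ∀ y, (G y).IsSymm) (hdet : IsUnit (G x).det)
    (v : EuclideanSpace ℝ (Fin n)) (a b : Fin n) :
    fderiv ℝ (fun y => G y a b) x v
      = (G x * connection G x v + (G x * connection G x v)ᵀ) a b := by
  simp only [fderiv_apply_eq_sum_pd, pd_entry_eq_christoffelFirst_add hG, mul_add,
    Finset.sum_add_distrib, Matrix.add_apply, Matrix.transpose_apply, mul_connection_apply hdet]

lemma hasDerivAt_dotProduct_mulVec_of_parallel (hG : ∀ y, (G y).IsSymm)
    {c : ℝ → EuclideanSpace ℝ (Fin n)} {v : EuclideanSpace ℝ (Fin n)} {t : ℝ}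
    (hdet : IsUnit (G (c t)).det) (hd : ∀ a b, DifferentiableAt ℝ (fun y => G y a b) (c t))
    (hc : HasDerivAt c v t) {X Y : ℝ → Fin n → ℝ}
    (hX : HasDerivAt X (-(connection G (c t) v *ᵥ X t)) t)
    (hY : HasDerivAt Y (-(connection G (c t) v *ᵥ Y t)) t) :
    HasDerivAt (fun s => X s ⬝ᵥ G (c s) *ᵥ Y s) 0 t := by
  have hM (a b : Fin n) : HasDerivAt (fun s => G (c s) a b)
      ((G (c t) * connection G (c t) v + (G (c t) * connection G (c t) v)ᵀ) a b) t := by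
    rw [← fderiv_entry_apply hG hdet]
    exact (hd a b).hasFDerivAt.comp_hasDerivAt t hc
  refine (hasDerivAt_dotProduct_mulVec hM hX hY).congr_deriv ?_
  have hskew : X t ⬝ᵥ (G (c t) * connection G (c t) v)ᵀ *ᵥ Y t
      = (connection G (c t) v *ᵥ X t) ⬝ᵥ G (c t) *ᵥ Y t := by
    rw [Matrix.transpose_mul, (hG _).eq, ← Matrix.mulVec_mulVec, Matrix.dotProduct_mulVec,
      Matrix.vecMul_transpose]
  rw [Matrix.add_mulVec, dotProduct_add, hskew, Matrix.mulVec_neg, Matrix.mulVec_mulVec,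
    neg_dotProduct, dotProduct_neg]
  ring

end Connection

section NormalPoints

variable {n : ℕ} {G : EuclideanSpace ℝ (Fin n) → Matrix (Fin n) (Fin n) ℝ}
  {x : EuclideanSpace ℝ (Fin n)}

/-- The coordinates are normal at `x`: there the metric components `G` form the identity matrix and
the Christoffel symbols vanish. Symmetry is asked of `G` everywhere, smoothness only near `x`. -/
structure IsNormalAt (G : EuclideanSpace ℝ (Fin n) → Matrix (Fin n) (Fin n) ℝ)
    (x : EuclideanSpace ℝ (Fin n)) : Prop where
  isSymm : ∀ y, (G y).IsSymm
  contDiffAt : ∀ a b, ContDiffAt ℝ ∞ (fun y => G y a b) x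
  eq_one : G x = 1
  christoffel_eq_zero : ∀ i j k, christoffel G i j k x = 0

namespace IsNormalAt

variable (hG : IsNormalAt G x)
include hG

lemma isUnit_det : IsUnit (G x).det := by simp [hG.eq_one]

lemma contDiffAt_christoffel (i j k : Fin n) : ContDiffAt ℝ ∞ (christoffel G i j k) x :=
  GeodesicCoords.contDiffAt_christoffel hG.contDiffAt hG.isUnit_det (by simp) i j k

lemma pd_entry_eq_zero (c a b : Fin n) : pd c (fun y => G y a b) x = 0 := by
  simp [pd_entry_eq_christoffelFirst_add hG.isSymm, ← sum_mul_christoffel hG.isUnit_det,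
    hG.christoffel_eq_zero]

lemma christoffelFirst_eventuallyEq (l j k : Fin n) :
    christoffelFirst G l j k =ᶠ[𝓝 x] fun y => ∑ i, G y l i * christoffel G i j k y := by
  filter_upwards [(contDiffAt_det hG.contDiffAt).continuousAt.eventually_ne
    hG.isUnit_det.ne_zero] with y hy
  exact (sum_mul_christoffel (isUnit_iff_ne_zero.2 hy) l j k).symm

lemma pd_christoffelFirst (c l j k : Fin n) :
    pd c (christoffelFirst G l j k) x = pd c (christoffel G l j k) x := by
  have hg (i : Fin n) := (hG.contDiffAt l i).differentiableAt (by simp)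
  have hC (i : Fin n) := (hG.contDiffAt_christoffel i j k).differentiableAt (by simp)
  rw [pd_congr (hG.christoffelFirst_eventuallyEq l j k), pd_sum fun i _ => (hg i).fun_mul (hC i)]
  simp [pd_mul (hg _) (hC _), hG.eq_one, hG.christoffel_eq_zero, Matrix.one_apply]

lemma pd_pd_christoffelFirst (b c l j k : Fin n) :
    pd b (pd c (christoffelFirst G l j k)) x = pd b (pd c (christoffel G l j k)) x := by
  have hg (i : Fin n) := (hG.contDiffAt l i).of_le (m := 2) ENat.LEInfty.out
  have hC (i : Fin n) := (hG.contDiffAt_christoffel i j k).of_le (m := 2) ENat.LEInfty.out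
  rw [pd_congr (pd_eventuallyEq (hG.christoffelFirst_eventuallyEq l j k) c),
    pd_pd_sum fun i _ => (hg i).mul (hC i)]
  simp [pd_pd_mul (hg _) (hC _), hG.eq_one, hG.christoffel_eq_zero, hG.pd_entry_eq_zero,
    Matrix.one_apply]

lemma pd_christoffel_mul_christoffel (b i j k i' j' k' : Fin n) :
    pd b (fun y => christoffel G i j k y * christoffel G i' j' k' y) x = 0 := by
  rw [pd_mul ((hG.contDiffAt_christoffel i j k).differentiableAt (by simp))
    ((hG.contDiffAt_christoffel i' j' k').differentiableAt (by simp))]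
  simp [hG.christoffel_eq_zero]

lemma covDeriv_riemann (b : Fin n) (a : Fin 3 → Fin n) (i : Fin n) :
    covDeriv G (riemann G) x (Fin.cons (α := fun _ : Fin 4 => Fin n) b a) i
      = pd b (pd (a 0) (christoffel G i (a 1) (a 2))) x
        - pd b (pd (a 1) (christoffel G i (a 0) (a 2))) x := by
  have hC (j k l : Fin n) := (hG.contDiffAt_christoffel j k l).differentiableAt (by simp)
  have hpd (c j k l : Fin n) : DifferentiableAt ℝ (pd c (christoffel G j k l)) x :=
    (contDiffAt_pd (m := ∞) (hG.contDiffAt_christoffel j k l) (by simp) c).differentiableAt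
      (by simp)
  have hquad (m : Fin n) := ((hC i (a 0) m).fun_mul (hC m (a 1) (a 2))).fun_sub
    ((hC i (a 1) m).fun_mul (hC m (a 0) (a 2)))
  have pd_quadratic : pd b (fun y => ∑ m, (christoffel G i (a 0) m y * christoffel G m (a 1) (a 2) y
      - christoffel G i (a 1) m y * christoffel G m (a 0) (a 2) y)) x = 0 := by
    rw [pd_sum fun m _ => hquad m]
    refine Finset.sum_eq_zero fun m _ => ?_
    rw [pd_sub ((hC _ _ _).fun_mul (hC _ _ _)) ((hC _ _ _).fun_mul (hC _ _ _)),
      hG.pd_christoffel_mul_christoffel, hG.pd_christoffel_mul_christoffel, sub_zero]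
  simp only [covDeriv, hG.christoffel_eq_zero, zero_mul, Finset.sum_const_zero, add_zero, sub_zero,
    Fin.cons_zero, Fin.tail_cons, riemann]
  rw [pd_add ((hpd _ _ _ _).fun_sub (hpd _ _ _ _)) (DifferentiableAt.fun_sum fun m _ => hquad m),
    pd_sub (hpd _ _ _ _) (hpd _ _ _ _), pd_quadratic, add_zero]

end IsNormalAt

end NormalPoints

section Axis

variable {n : ℕ} [NeZero n] {G : EuclideanSpace ℝ (Fin n) → Matrix (Fin n) (Fin n) ℝ}

lemma pd_zero_pd_christoffel_axis (hG : ∀ t, IsNormalAt G (axis t)) {t : ℝ}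
    (hR : ∀ (a : Fin 3 → Fin n) (i : Fin n), covDeriv G (riemann G) (axis t)
      (Fin.cons (α := fun _ : Fin 4 => Fin n) 0 a) i = 0) (i j k : Fin n) :
    pd 0 (pd j (christoffel G i 0 k)) (axis t) = 0 := by
  have curvature_parallel := hR ![j, 0, k] i
  have pd_zero_pd_zero : pd 0 (pd 0 (christoffel G i j k)) (axis t) = 0 :=
    iterate_pd_zero_axis_eq_zero (fun s => (hG s).christoffel_eq_zero i j k)
      (fun s => (hG s).contDiffAt_christoffel i j k) 2 t
  rw [(hG t).covDeriv_riemann] at curvature_parallel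
  simpa [pd_zero_pd_zero] using curvature_parallel

lemma pd_zero_christoffel_axis (hG : ∀ t, IsNormalAt G (axis t)) (i j k : Fin n) (t : ℝ) :
    pd 0 (christoffel G i j k) (axis t) = 0 :=
  pd_zero_axis_eq_zero (fun s => (hG s).christoffel_eq_zero i j k)
    (((hG t).contDiffAt_christoffel i j k).differentiableAt (by simp))

lemma pd_christoffel_zero_zero_zero_axis (hG : ∀ t, IsNormalAt G (axis t)) (k : Fin n) (t : ℝ) :
    pd k (christoffel G 0 0 0) (axis t) = 0 := by
  calc pd k (christoffel G 0 0 0) (axis t)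
      = pd k (christoffelFirst G 0 0 0) (axis t) := ((hG t).pd_christoffelFirst k 0 0 0).symm
    _ = pd 0 (christoffelFirst G 0 0 k) (axis t) :=
        pd_christoffelFirst_diag_comm (hG t).isSymm
          (((hG t).contDiffAt 0 0).of_le ENat.LEInfty.out) k 0
    _ = pd 0 (christoffel G 0 0 k) (axis t) := (hG t).pd_christoffelFirst 0 0 0 k
    _ = 0 := pd_zero_christoffel_axis hG 0 0 k t

lemma pd_pd_christoffel_zero_zero_zero_axis (hG : ∀ t, IsNormalAt G (axis t)) {t : ℝ}
    (hR : ∀ (a : Fin 3 → Fin n) (i : Fin n), covDeriv G (riemann G) (axis t)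
      (Fin.cons (α := fun _ : Fin 4 => Fin n) 0 a) i = 0) (j k : Fin n) :
    pd j (pd k (christoffel G 0 0 0)) (axis t) = 0 := by
  have smooth_entry : ContDiffAt ℝ 2 (fun y => G y 0 0) (axis t) :=
    ((hG t).contDiffAt 0 0).of_le ENat.LEInfty.out
  have diag_comm : pd k (christoffelFirst G 0 0 0) =ᶠ[𝓝 (axis t)]
      pd 0 (christoffelFirst G 0 0 k) := by
    filter_upwards [smooth_entry.eventually (by simp)] with y hy
      using pd_christoffelFirst_diag_comm (hG t).isSymm hy k 0
  calc pd j (pd k (christoffel G 0 0 0)) (axis t)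
      = pd j (pd k (christoffelFirst G 0 0 0)) (axis t) :=
        ((hG t).pd_pd_christoffelFirst j k 0 0 0).symm
    _ = pd j (pd 0 (christoffelFirst G 0 0 k)) (axis t) := pd_congr diag_comm j
    _ = pd j (pd 0 (christoffel G 0 0 k)) (axis t) := (hG t).pd_pd_christoffelFirst j 0 0 0 k
    _ = pd 0 (pd j (christoffel G 0 0 k)) (axis t) :=
        pd_comm (((hG t).contDiffAt_christoffel 0 0 k).of_le ENat.LEInfty.out) j 0
    _ = 0 := pd_zero_pd_christoffel_axis hG hR 0 j k

end Axis

section Differential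

variable {n : ℕ} {N : Type*} [TopologicalSpace N] [ChartedSpace (EuclideanSpace ℝ (Fin n)) N]
  {φ : EuclideanSpace ℝ (Fin n) → N} {x : EuclideanSpace ℝ (Fin n)}

/-- The differential `dφ(x)` of a parametrization, with the tangent spaces of `N` identified with
the model space so that it is a linear map between fixed spaces. -/
noncomputable def differential (φ : EuclideanSpace ℝ (Fin n) → N) (x : EuclideanSpace ℝ (Fin n)) :
    EuclideanSpace ℝ (Fin n) →L[ℝ] EuclideanSpace ℝ (Fin n) :=
  mfderiv 𝓘(ℝ, EuclideanSpace ℝ (Fin n)) (𝓡 n) φ x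

/-- The differential `dχ(p)` of a chart, with the tangent spaces of `N` identified with the model
space; `vecComp` reads off its coordinates. -/
noncomputable def chartDifferential (χ : OpenPartialHomeomorph N (EuclideanSpace ℝ (Fin n)))
    (p : N) : EuclideanSpace ℝ (Fin n) →L[ℝ] EuclideanSpace ℝ (Fin n) :=
  mfderiv (𝓡 n) 𝓘(ℝ, EuclideanSpace ℝ (Fin n)) χ p

lemma velocity_comp {c : ℝ → EuclideanSpace ℝ (Fin n)} {v : EuclideanSpace ℝ (Fin n)} {s : ℝ}
    (hφ : MDifferentiableAt 𝓘(ℝ, EuclideanSpace ℝ (Fin n)) (𝓡 n) φ (c s))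
    (hc : HasDerivAt c v s) : velocity (fun r => φ (c r)) s = differential φ (c s) v := by
  have hcomp := hφ.hasMFDerivAt.comp s hc.hasFDerivAt.hasMFDerivAt
  change mfderiv 𝓘(ℝ, ℝ) (𝓡 n) (φ ∘ c) s (1 : ℝ) = _
  rw [hcomp.mfderiv]
  exact congrArg (differential φ (c s)) (one_smul ℝ v)

lemma hasFDerivAt_chart_comp {χ : OpenPartialHomeomorph N (EuclideanSpace ℝ (Fin n))}
    (hχ : MDifferentiableAt (𝓡 n) 𝓘(ℝ, EuclideanSpace ℝ (Fin n)) χ (φ x))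
    (hφ : MDifferentiableAt 𝓘(ℝ, EuclideanSpace ℝ (Fin n)) (𝓡 n) φ x) :
    HasFDerivAt (fun y => χ (φ y)) ((chartDifferential χ (φ x)).comp (differential φ x)) x :=
  (hχ.hasMFDerivAt.comp x hφ.hasMFDerivAt).hasFDerivAt

lemma hasDerivAt_chart_comp {χ : OpenPartialHomeomorph N (EuclideanSpace ℝ (Fin n))} {c : ℝ → N}
    {t : ℝ} (hχ : MDifferentiableAt (𝓡 n) 𝓘(ℝ, EuclideanSpace ℝ (Fin n)) χ (c t))
    (hc : MDifferentiableAt 𝓘(ℝ, ℝ) (𝓡 n) c t) :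
    HasDerivAt (fun s => χ (c s)) (chartDifferential χ (c t) (velocity c t)) t :=
  have hcomp : HasFDerivAt (fun s => χ (c s)) ((chartDifferential χ (c t)).comp
      (show ℝ →L[ℝ] EuclideanSpace ℝ (Fin n) from mfderiv 𝓘(ℝ, ℝ) (𝓡 n) c t)) t :=
    (hχ.hasMFDerivAt.comp t hc.hasMFDerivAt).hasFDerivAt
  hcomp.hasDerivAt

end Differential

section InverseChart

variable {n : ℕ} {N : Type*} [TopologicalSpace N] [ChartedSpace (EuclideanSpace ℝ (Fin n)) N]
  {χ : OpenPartialHomeomorph N (EuclideanSpace ℝ (Fin n))}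
  {φ : EuclideanSpace ℝ (Fin n) → N} {x : EuclideanSpace ℝ (Fin n)}

/-- The chart `χ` of the smooth structure has the parametrization `φ` as its inverse. The two are
compared on `χ.target` only, so that `φ` may be defined and injective on a larger set. -/
structure IsInverseChart (χ : OpenPartialHomeomorph N (EuclideanSpace ℝ (Fin n)))
    (φ : EuclideanSpace ℝ (Fin n) → N) : Prop where
  mem_maximalAtlas : χ ∈ IsManifold.maximalAtlas (𝓡 n) ∞ N
  eqOn : Set.EqOn χ.symm φ χ.target

namespace IsInverseChart

lemma of_mem_maximalAtlas (hχ : χ ∈ IsManifold.maximalAtlas (𝓡 n) ∞ N) :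
    IsInverseChart χ χ.symm :=
  ⟨hχ, Set.eqOn_refl _ _⟩

variable (hχ : IsInverseChart χ φ)
include hχ

lemma mem_source (hx : x ∈ χ.target) : φ x ∈ χ.source :=
  hχ.eqOn hx ▸ χ.map_target hx

lemma right_inv (hx : x ∈ χ.target) : χ (φ x) = x :=
  hχ.eqOn hx ▸ χ.right_inv hx

lemma symm_eventuallyEq (hx : x ∈ χ.target) : χ.symm =ᶠ[𝓝 x] φ :=
  hχ.eqOn.eventuallyEq_of_mem (χ.open_target.mem_nhds hx)

lemma mdifferentiableAt_chart {p : N} (hp : p ∈ χ.source) :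
    MDifferentiableAt (𝓡 n) 𝓘(ℝ, EuclideanSpace ℝ (Fin n)) χ p :=
  (contMDiffAt_of_mem_maximalAtlas hχ.mem_maximalAtlas hp).mdifferentiableAt (by simp)

lemma mdifferentiableAt (hx : x ∈ χ.target) :
    MDifferentiableAt 𝓘(ℝ, EuclideanSpace ℝ (Fin n)) (𝓡 n) φ x :=
  (hχ.symm_eventuallyEq hx).mdifferentiableAt_iff.1 <|
    (contMDiffAt_symm_of_mem_maximalAtlas hχ.mem_maximalAtlas hx).mdifferentiableAt (by simp)

lemma chartDifferential_comp_differential (hx : x ∈ χ.target) :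
    (chartDifferential χ (φ x)).comp (differential φ x) = .id ℝ _ := by
  have hcomp := hasFDerivAt_chart_comp (hχ.mdifferentiableAt_chart (hχ.mem_source hx))
    (hχ.mdifferentiableAt hx)
  have hid : (fun y => χ (φ y)) =ᶠ[𝓝 x] id :=
    (χ.open_target.eventually_mem hx).mono fun y hy => hχ.right_inv hy
  exact hcomp.unique ((hasFDerivAt_id x).congr_of_eventuallyEq hid)

lemma chartDifferential_differential (hx : x ∈ χ.target) (v : EuclideanSpace ℝ (Fin n)) :
    chartDifferential χ (φ x) (differential φ x v) = v :=
  DFunLike.congr_fun (hχ.chartDifferential_comp_differential hx) v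

lemma differential_chartDifferential (hx : x ∈ χ.target) (v : EuclideanSpace ℝ (Fin n)) :
    differential φ x (chartDifferential χ (φ x) v) = v :=
  have hleft : (chartDifferential χ (φ x)).toLinearMap ∘ₗ (differential φ x).toLinearMap = .id :=
    congrArg ContinuousLinearMap.toLinearMap (hχ.chartDifferential_comp_differential hx)
  DFunLike.congr_fun ((LinearMap.comp_eq_id_comm _ _).1 hleft) v

end IsInverseChart

lemma differential_symm_chartDifferential (hχ : χ ∈ IsManifold.maximalAtlas (𝓡 n) ∞ N) {p : N}
    (hp : p ∈ χ.source) (v : EuclideanSpace ℝ (Fin n)) :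
    differential χ.symm (χ p) (chartDifferential χ p v) = v := by
  simpa only [χ.left_inv hp] using
    (IsInverseChart.of_mem_maximalAtlas hχ).differential_chartDifferential (χ.map_source hp) v

end InverseChart

section MetricComponents

variable {n : ℕ} {N : Type*} [TopologicalSpace N] [ChartedSpace (EuclideanSpace ℝ (Fin n)) N]
  [IsManifold (𝓡 n) ∞ N] {φ φ' : EuclideanSpace ℝ (Fin n) → N} {x : EuclideanSpace ℝ (Fin n)}

/-- The scalar product at `p`, with the tangent space identified with the model space. -/
noncomputable def innerAt (h : Metric n N) (p : N) :
    EuclideanSpace ℝ (Fin n) →L[ℝ] EuclideanSpace ℝ (Fin n) →L[ℝ] ℝ :=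
  h.inner p

lemma metricComp_isSymm (h : Metric n N) (φ : EuclideanSpace ℝ (Fin n) → N)
    (x : EuclideanSpace ℝ (Fin n)) : (metricComp h φ x).IsSymm :=
  .ext fun _ _ => h.symm _ _ _

lemma metricComp_eventuallyEq (h : Metric n N) (hφ : φ =ᶠ[𝓝 x] φ') :
    metricComp h φ =ᶠ[𝓝 x] metricComp h φ' := by
  filter_upwards [hφ.eventuallyEq_nhds] with y hy
  have hd : differential φ y = differential φ' y := hy.mfderiv_eq
  ext i j
  change innerAt h (φ y) (differential φ y _) (differential φ y _) = _
  rw [hd, hy.self_of_nhds]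
  rfl

lemma dotProduct_metricComp_mulVec (h : Metric n N) (φ : EuclideanSpace ℝ (Fin n) → N)
    (x v w : EuclideanSpace ℝ (Fin n)) :
    v.ofLp ⬝ᵥ metricComp h φ x *ᵥ w.ofLp
      = innerAt h (φ x) (differential φ x v) (differential φ x w) := by
  let B := LinearMap.mk₂ ℝ (fun v w => innerAt h (φ x) (differential φ x v) (differential φ x w))
    (by simp) (by simp) (by simp) (by simp)
  let b := (EuclideanSpace.basisFun (Fin n) ℝ).toBasis
  have hB : LinearMap.toMatrix₂ b b B = metricComp h φ x := by
    ext i j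
    simp only [B, b, LinearMap.toMatrix₂_apply, OrthonormalBasis.coe_toBasis,
      EuclideanSpace.basisFun_apply, LinearMap.mk₂_apply]
    rfl
  rw [← hB]
  exact (apply_eq_dotProduct_toMatrix₂_mulVec b b B v w).symm

lemma metricComp_posDef_iff (h : Metric n N) :
    (metricComp h φ x).PosDef ↔ Function.Injective (differential φ x) := by
  refine ⟨fun hpos => (injective_iff_map_eq_zero _).2 fun v hv => ?_, fun hφ =>
    .of_dotProduct_mulVec_pos (metricComp_isSymm h φ x) fun v hv => ?_⟩
  · by_contra hv0
    have hvv := hpos.dotProduct_mulVec_pos (x := v.ofLp) (by simpa using hv0)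
    rw [star_trivial, dotProduct_metricComp_mulVec, hv, map_zero] at hvv
    exact hvv.false
  · have hdv : differential φ x (.toLp 2 v) ≠ 0 := by simpa [hφ.eq_iff' (map_zero _)] using hv
    exact (h.pos _ _ hdv).trans_eq
      (dotProduct_metricComp_mulVec h φ x (.toLp 2 v) (.toLp 2 v)).symm

lemma contDiffOn_metricComp (h : Metric n N) {V : Set (EuclideanSpace ℝ (Fin n))} (hV : IsOpen V)
    (hφ : ContMDiffOn 𝓘(ℝ, EuclideanSpace ℝ (Fin n)) (𝓡 n) ∞ φ V) (i j : Fin n) :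
    ContDiffOn ℝ ∞ (fun x => metricComp h φ x i j) V := by
  have hpush (v : EuclideanSpace ℝ (Fin n)) :
      ContMDiffOn 𝓘(ℝ, EuclideanSpace ℝ (Fin n)) (𝓡 n).tangent ∞
        (fun x => (⟨φ x, differential φ x v⟩ : TangentBundle (𝓡 n) N)) V := by
    have hconst : ContMDiffOn 𝓘(ℝ, EuclideanSpace ℝ (Fin n))
        (𝓘(ℝ, EuclideanSpace ℝ (Fin n))).tangent ∞
        (fun x => (⟨x, v⟩ : TangentBundle 𝓘(ℝ, EuclideanSpace ℝ (Fin n))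
          (EuclideanSpace ℝ (Fin n)))) V :=
      contMDiffOn_vectorSpace_iff_contDiffOn.2 contDiffOn_const
    refine ((hφ.contMDiffOn_tangentMapWithin (m := ∞) (by simp) hV.uniqueMDiffOn).comp hconst
      fun x hx => hx).congr fun x hx => ?_
    simp only [Function.comp, tangentMapWithin, mfderivWithin_of_isOpen hV hx]
    rfl
  intro x hx
  have hinner := ContMDiffWithinAt.clm_bundle_apply₂ (F₁ := EuclideanSpace ℝ (Fin n))
    (F₂ := EuclideanSpace ℝ (Fin n)) (F₃ := ℝ) (E₃ := Bundle.Trivial N ℝ) (b := φ)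
    (ψ := fun y => h.inner (φ y)) (h.contMDiff.contMDiffAt.comp_contMDiffWithinAt x (hφ x hx))
    (hpush (EuclideanSpace.single i 1) x hx) (hpush (EuclideanSpace.single j 1) x hx)
  exact (Bundle.contMDiffWithinAt_totalSpace.1 hinner).2.contDiffWithinAt

lemma IsInverseChart.metricComp_eventuallyEq
    {χ : OpenPartialHomeomorph N (EuclideanSpace ℝ (Fin n))} (hχ : IsInverseChart χ φ)
    (hx : x ∈ χ.target) (h : Metric n N) : metricComp h χ.symm =ᶠ[𝓝 x] metricComp h φ :=
  GeodesicCoords.metricComp_eventuallyEq h (hχ.symm_eventuallyEq hx)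

lemma IsInverseChart.isUnit_det_metricComp
    {χ : OpenPartialHomeomorph N (EuclideanSpace ℝ (Fin n))} (hχ : IsInverseChart χ φ)
    (hx : x ∈ χ.target) (h : Metric n N) : IsUnit (metricComp h φ x).det :=
  ((metricComp_posDef_iff h).2 (Function.LeftInverse.injective
    (hχ.chartDifferential_differential hx))).det_pos.ne'.isUnit

end MetricComponents

section InverseFunction

lemma exists_openPartialHomeomorph_of_hasFDerivAt_equiv {𝕜 E F : Type*} [RCLike 𝕜]
    [NormedAddCommGroup E] [NormedSpace 𝕜 E] [CompleteSpace E] [NormedAddCommGroup F]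
    [NormedSpace 𝕜 F] {f : E → F} {V : Set E} {k : WithTop ℕ∞} (hV : IsOpen V)
    (hf : ContDiffOn 𝕜 k f V) (hk : 1 ≤ k) {x : E} (hx : x ∈ V) {L : E ≃L[𝕜] F}
    (hL : HasFDerivAt f (L : E →L[𝕜] F) x) :
    ∃ R : OpenPartialHomeomorph E F, x ∈ R.source ∧ R.source ⊆ V ∧ (∀ y, R y = f y) ∧
      ContDiffOn 𝕜 k R.symm R.target := by
  have hk0 : k ≠ 0 := ENat.one_le_iff_ne_zero_withTop.1 hk
  have hfx := hf.contDiffAt (hV.mem_nhds hx)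
  set D := V ∩ fderiv 𝕜 f ⁻¹' Set.range ((↑) : (E ≃L[𝕜] F) → E →L[𝕜] F)
  have hD : IsOpen D := (hf.continuousOn_fderiv_of_isOpen hV hk).isOpen_inter_preimage hV
    ContinuousLinearEquiv.isOpen
  refine ⟨(hfx.toOpenPartialHomeomorph f hL hk0).restrOpen D hD,
    ⟨hfx.mem_toOpenPartialHomeomorph_source hL hk0, hx, L, hL.fderiv.symm⟩,
    fun y hy => hy.2.1, fun y => rfl, fun z hz => ?_⟩
  obtain ⟨-, hyV, L', hL'⟩ := OpenPartialHomeomorph.map_target _ hz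
  have hfy := hf.contDiffAt (hV.mem_nhds hyV)
  refine (OpenPartialHomeomorph.contDiffAt_symm _ (f₀' := L') hz ?_ hfy).contDiffWithinAt
  rw [hL']
  exact (hfy.differentiableAt hk0).hasFDerivAt

variable {n : ℕ} {N : Type*} [TopologicalSpace N] [ChartedSpace (EuclideanSpace ℝ (Fin n)) N]
  [IsManifold (𝓡 n) ∞ N] {σ : EuclideanSpace ℝ (Fin n) → N} {x : EuclideanSpace ℝ (Fin n)}

lemma IsInverseChart.chart_trans_symm
    {ψ : OpenPartialHomeomorph N (EuclideanSpace ℝ (Fin n))}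
    (hψ : ψ ∈ IsManifold.maximalAtlas (𝓡 n) ∞ N)
    {R : OpenPartialHomeomorph (EuclideanSpace ℝ (Fin n)) (EuclideanSpace ℝ (Fin n))}
    (hR : ContDiffOn ℝ ∞ R R.source) (hR' : ContDiffOn ℝ ∞ R.symm R.target)
    (hσ : ∀ y ∈ R.source, σ y ∈ ψ.source ∧ R y = ψ (σ y)) :
    IsInverseChart (ψ.trans R.symm) σ where
  mem_maximalAtlas := OpenPartialHomeomorph.mem_maximalAtlas_of_contMDiffOn _
    (hR'.contMDiffOn.comp ((contMDiffOn_of_mem_maximalAtlas hψ).mono fun _ hp => hp.1)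
      fun _ hp => hp.2)
    ((contMDiffOn_symm_of_mem_maximalAtlas hψ).comp (hR.mono fun _ hy => hy.1).contMDiffOn
      fun _ hy => hy.2)
  eqOn y hy := by
    obtain ⟨hσy, hRy⟩ := hσ y hy.1
    exact (congrArg ψ.symm hRy).trans (ψ.left_inv hσy)

lemma exists_isInverseChart {U : Set (EuclideanSpace ℝ (Fin n))}
    (hU : IsOpen U) (hσ : ContMDiffOn 𝓘(ℝ, EuclideanSpace ℝ (Fin n)) (𝓡 n) ∞ σ U) (hx : x ∈ U)
    (hinj : Function.Injective (differential σ x)) :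
    ∃ χ : OpenPartialHomeomorph N (EuclideanSpace ℝ (Fin n)),
      IsInverseChart χ σ ∧ x ∈ χ.target ∧ χ.target ⊆ U := by
  set ψ := chartAt (EuclideanSpace ℝ (Fin n)) (σ x)
  have hψ : ψ ∈ IsManifold.maximalAtlas (𝓡 n) ∞ N := IsManifold.chart_mem_maximalAtlas _
  have hψx : σ x ∈ ψ.source := mem_chart_source _ _
  set V := U ∩ σ ⁻¹' ψ.source
  have hV : IsOpen V := hσ.continuousOn.isOpen_inter_preimage hU ψ.open_source
  have hF : ContDiffOn ℝ ∞ (fun y => ψ (σ y)) V := contMDiffOn_iff_contDiffOn.1 <|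
    (contMDiffOn_of_mem_maximalAtlas hψ).comp (hσ.mono Set.inter_subset_left) fun y hy => hy.2
  have hψinj : Function.Injective (chartDifferential ψ (σ x)) :=
    Function.LeftInverse.injective (differential_symm_chartDifferential hψ hψx)
  have hFx := hasFDerivAt_chart_comp
    ((IsInverseChart.of_mem_maximalAtlas hψ).mdifferentiableAt_chart hψx)
    ((hσ.contMDiffAt (hU.mem_nhds hx)).mdifferentiableAt (by simp))
  set L := (LinearEquiv.ofInjectiveEndo ((chartDifferential ψ (σ x)).comp
    (differential σ x)).toLinearMap (hψinj.comp hinj)).toContinuousLinearEquiv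
  have hL : HasFDerivAt (fun y => ψ (σ y)) (L : _ →L[ℝ] EuclideanSpace ℝ (Fin n)) x :=
    hFx.congr_fderiv (by ext1; rfl)
  obtain ⟨R, hxR, hRV, hRF, hRsymm⟩ :=
    exists_openPartialHomeomorph_of_hasFDerivAt_equiv hV hF (by simp) ⟨hx, hψx⟩ hL
  have hRsmooth : ContDiffOn ℝ ∞ R R.source := (hF.mono hRV).congr fun y _ => hRF y
  refine ⟨ψ.trans R.symm,
    .chart_trans_symm hψ hRsmooth hRsymm fun y hy => ⟨(hRV hy).2, hRF y⟩, ?_, fun y hy => ?_⟩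
  · exact ⟨hxR, by simpa [hRF] using ψ.map_source hψx⟩
  · exact (hRV hy.1).1

end InverseFunction

section ParallelTransport

variable {n : ℕ} {N : Type*} [TopologicalSpace N] [ChartedSpace (EuclideanSpace ℝ (Fin n)) N]
  [IsManifold (𝓡 n) ∞ N] {h : Metric n N} {γ : ℝ → N}
  {χ : OpenPartialHomeomorph N (EuclideanSpace ℝ (Fin n))}

lemma IsParallelOn.hasDerivAt_vecComp {V : (t : ℝ) → TangentSpace (𝓡 n) (γ t)} {J : Set ℝ}
    (hV : IsParallelOn h γ V J) {t : ℝ} (ht : t ∈ J)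
    (hχ : χ ∈ IsManifold.maximalAtlas (𝓡 n) ∞ N) (hγt : γ t ∈ χ.source) :
    HasDerivAt (fun s => vecComp χ (γ s) (V s))
      (-(connection (metricComp h χ.symm) (χ (γ t)) (chartDifferential χ (γ t) (velocity γ t))
        *ᵥ vecComp χ (γ t) (V t))) t :=
  hasDerivAt_pi.2 fun k => (hV t ht χ hχ hγt k).congr_deriv
    (congrArg Neg.neg (connection_mulVec _ _ k).symm)

lemma innerAt_eq_dotProduct_vecComp (hχ : χ ∈ IsManifold.maximalAtlas (𝓡 n) ∞ N) {p : N}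
    (hp : p ∈ χ.source) (v w : EuclideanSpace ℝ (Fin n)) :
    innerAt h p v w = vecComp χ p v ⬝ᵥ metricComp h χ.symm (χ p) *ᵥ vecComp χ p w := by
  have hdot := dotProduct_metricComp_mulVec h χ.symm (χ p) (chartDifferential χ p v)
    (chartDifferential χ p w)
  rw [differential_symm_chartDifferential hχ hp, differential_symm_chartDifferential hχ hp,
    χ.left_inv hp] at hdot
  exact hdot.symm

lemma hasDerivAt_innerAt_of_isParallelOn {V W : (t : ℝ) → TangentSpace (𝓡 n) (γ t)} {J : Set ℝ}
    (hV : IsParallelOn h γ V J) (hW : IsParallelOn h γ W J) {t : ℝ} (ht : t ∈ J)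
    (hγ : MDifferentiableAt 𝓘(ℝ, ℝ) (𝓡 n) γ t) :
    HasDerivAt (fun s => innerAt h (γ s) (V s) (W s)) 0 t := by
  set χ := chartAt (EuclideanSpace ℝ (Fin n)) (γ t)
  have hχ : χ ∈ IsManifold.maximalAtlas (𝓡 n) ∞ N := IsManifold.chart_mem_maximalAtlas _
  have hinv := IsInverseChart.of_mem_maximalAtlas hχ
  have hγt : γ t ∈ χ.source := mem_chart_source _ _
  have hxt : χ (γ t) ∈ χ.target := χ.map_source hγt
  have hsmooth (a b : Fin n) :
      DifferentiableAt ℝ (fun y => metricComp h χ.symm y a b) (χ (γ t)) :=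
    ((contDiffOn_metricComp h χ.open_target (contMDiffOn_symm_of_mem_maximalAtlas hχ) a b
      ).contDiffAt (χ.open_target.mem_nhds hxt)).differentiableAt (by simp)
  refine (hasDerivAt_dotProduct_mulVec_of_parallel (metricComp_isSymm h _)
    (hinv.isUnit_det_metricComp hxt h) hsmooth
    (hasDerivAt_chart_comp (hinv.mdifferentiableAt_chart hγt) hγ)
    (hV.hasDerivAt_vecComp ht hχ hγt) (hW.hasDerivAt_vecComp ht hχ hγt)).congr_of_eventuallyEq ?_
  filter_upwards [hγ.continuousAt.preimage_mem_nhds (χ.open_source.mem_nhds hγt)] with s hs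
  exact innerAt_eq_dotProduct_vecComp hχ hs _ _

lemma innerAt_eq_of_isParallelOn {V W : (t : ℝ) → TangentSpace (𝓡 n) (γ t)}
    (hV : IsParallelOn h γ V Set.univ) (hW : IsParallelOn h γ W Set.univ)
    (hγ : MDifferentiable 𝓘(ℝ, ℝ) (𝓡 n) γ) (s t : ℝ) :
    innerAt h (γ s) (V s) (W s) = innerAt h (γ t) (V t) (W t) :=
  have hderiv (r : ℝ) := hasDerivAt_innerAt_of_isParallelOn hV hW (Set.mem_univ r) (hγ r)
  is_const_of_deriv_eq_zero (fun r => (hderiv r).differentiableAt) (fun r => (hderiv r).deriv) s t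

lemma IsInverseChart.connection_mulVec_eq_zero {σ : EuclideanSpace ℝ (Fin n) → N}
    (hχ : IsInverseChart χ σ) {v w : EuclideanSpace ℝ (Fin n)}
    {c : ℝ → EuclideanSpace ℝ (Fin n)} {s : ℝ} (hcs : c s ∈ χ.target) (hc : HasDerivAt c v s)
    {V : (r : ℝ) → TangentSpace (𝓡 n) (σ (c r))} {J : Set ℝ} (hs : s ∈ J)
    (hV : IsParallelOn h (fun r => σ (c r)) V J)
    (hVw : ∀ᶠ r in 𝓝 s, V r = differential σ (c r) w) :
    connection (metricComp h σ) (c s) v *ᵥ w.ofLp = 0 := by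
  have hcomp : (fun r => vecComp χ (σ (c r)) (V r)) =ᶠ[𝓝 s] fun _ => w.ofLp := by
    filter_upwards [hVw, hc.continuousAt.preimage_mem_nhds (χ.open_target.mem_nhds hcs)]
      with r hr hcr
    rw [hr]
    exact congrArg WithLp.ofLp (hχ.chartDifferential_differential hcr w)
  have hparallel := hV.hasDerivAt_vecComp hs hχ.mem_maximalAtlas (hχ.mem_source hcs)
  rw [show vecComp χ (σ (c s)) (V s) = w.ofLp from hcomp.self_of_nhds,
    velocity_comp (hχ.mdifferentiableAt hcs) hc, hχ.chartDifferential_differential hcs,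
    hχ.right_inv hcs, connection_congr (hχ.metricComp_eventuallyEq hcs h)] at hparallel
  exact neg_eq_zero.1 <|
    hparallel.unique ((hasDerivAt_const s w.ofLp).congr_of_eventuallyEq hcomp)

end ParallelTransport

section NormalCoordinates

variable {n : ℕ} [NeZero n]

lemma axis_apply_zero (t : ℝ) : (axis t : EuclideanSpace ℝ (Fin n)) 0 = t := by
  simp [axis]

lemma scaleTransversal_axis_add (s t : ℝ) {w : EuclideanSpace ℝ (Fin n)} (hw : w 0 = 0) :
    scaleTransversal s (axis t + w) = axis t + s • w := by
  ext i
  rcases eq_or_ne i 0 with rfl | hi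
  · simp [scaleTransversal, axis, hw]
  · simp [scaleTransversal, axis, hi]

lemma exists_add_smul_mem {E : Type*} [AddCommGroup E] [Module ℝ E] [TopologicalSpace E]
    [ContinuousAdd E] [ContinuousSMul ℝ E] {U : Set E} (hU : IsOpen U) {x : E} (hx : x ∈ U)
    (w : E) : ∃ ε : ℝ, ε ≠ 0 ∧ x + ε • w ∈ U := by
  have hcont : Continuous fun ε : ℝ => x + ε • w := by fun_prop
  have hmem : ∀ᶠ ε in 𝓝[≠] (0 : ℝ), x + ε • w ∈ U :=
    (hcont.continuousAt.eventually (by simpa using hU.mem_nhds hx)).filter_mono nhdsWithin_le_nhds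
  exact (hmem.and self_mem_nhdsWithin).exists.imp fun _ => And.symm

lemma hasDerivAt_add_smul {E : Type*} [NormedAddCommGroup E] [NormedSpace ℝ E] (x w : E) (s : ℝ) :
    HasDerivAt (fun r : ℝ => x + r • w) w s := by
  simpa using ((hasDerivAt_id s).smul_const w).const_add x

variable {N : Type*} [TopologicalSpace N] [ChartedSpace (EuclideanSpace ℝ (Fin n)) N]
  [IsManifold (𝓡 n) ∞ N] {h : Metric n N} {γ : ℝ → N}
  {e : Fin n → (t : ℝ) → TangentSpace (𝓡 n) (γ t)}
  {U : Set (EuclideanSpace ℝ (Fin n))} {σ : EuclideanSpace ℝ (Fin n) → N}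

/-- The tensor `∇_{γ̇} R` vanishes at the points of `γ`: the case `j = 0` of
`IsLocallySymmetricAlong`. -/
def IsCurvatureParallelAlong (h : Metric n N) (γ : ℝ → N) : Prop :=
  ∀ t : ℝ, ∀ χ ∈ IsManifold.maximalAtlas (𝓡 n) ∞ N, γ t ∈ χ.source →
    ∀ (a : Fin 3 → Fin n) (i : Fin n),
      ∑ b, vecComp χ (γ t) (velocity γ t) b *
        covDeriv (metricComp h χ.symm) (riemann (metricComp h χ.symm)) (χ (γ t))
          (Fin.cons (α := fun _ : Fin 4 => Fin n) b a) i = 0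

namespace IsGeodesicNormalCoordinates

variable (hσ : IsGeodesicNormalCoordinates h γ e U σ)
include hσ

lemma comp_axis : (fun t => σ (axis t)) = γ := by
  ext t
  have hscale : scaleTransversal 0 (axis t) = (axis t : EuclideanSpace ℝ (Fin n)) := by
    simpa using scaleTransversal_axis_add 0 t (w := (0 : EuclideanSpace ℝ (Fin n))) rfl
  simpa [axis_apply_zero, hscale] using
    congrArg Bundle.TotalSpace.proj (hσ.initial _ (hσ.axis_mem t))

lemma mdifferentiableAt {x : EuclideanSpace ℝ (Fin n)} (hx : x ∈ U) :
    MDifferentiableAt 𝓘(ℝ, EuclideanSpace ℝ (Fin n)) (𝓡 n) σ x :=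
  (hσ.smooth.contMDiffAt (hσ.isOpen.mem_nhds hx)).mdifferentiableAt (by simp)

lemma mdifferentiable_curve : MDifferentiable 𝓘(ℝ, ℝ) (𝓡 n) γ := by
  rw [← hσ.comp_axis]
  exact fun t => (hσ.mdifferentiableAt (hσ.axis_mem t)).comp t
    (hasDerivAt_axis t).differentiableAt.mdifferentiableAt

lemma differential_axis_single_zero (t : ℝ) :
    differential σ (axis t) (EuclideanSpace.single 0 1) = velocity γ t := by
  rw [← velocity_comp (hσ.mdifferentiableAt (hσ.axis_mem t)) (hasDerivAt_axis t), hσ.comp_axis]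

lemma isGeodesicOn_axis_add_smul {t : ℝ} {w : EuclideanSpace ℝ (Fin n)} (hw : w 0 = 0)
    (hmem : axis t + w ∈ U) :
    IsGeodesicOn h (fun s : ℝ => σ (axis t + s • w)) {s : ℝ | axis t + s • w ∈ U} := by
  simpa only [scaleTransversal_axis_add _ _ hw] using hσ.geodesic _ hmem

lemma differential_axis_of_add_mem {t : ℝ} {w : EuclideanSpace ℝ (Fin n)} (hw : w 0 = 0)
    (hmem : axis t + w ∈ U) :
    differential σ (axis t) w
      = ∑ j with j ≠ 0, w j • (show EuclideanSpace ℝ (Fin n) from e j t) := by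
  -- `e` with values in a fixed space, so that the parameter `r` can be rewritten
  let E (j : Fin n) (r : ℝ) : EuclideanSpace ℝ (Fin n) := e j r
  have hstart : (axis t + w : EuclideanSpace ℝ (Fin n)) 0 = t := by simp [axis_apply_zero, hw]
  have hscale (s : ℝ) := scaleTransversal_axis_add s t hw
  have hzero : scaleTransversal 0 (axis t + w) = axis t := by simp [hscale]
  have hderiv : HasDerivAt (fun s => scaleTransversal s (axis t + w)) w 0 := by
    simpa only [hscale] using hasDerivAt_add_smul (axis t) w 0
  have hvel := velocity_comp (hzero ▸ hσ.mdifferentiableAt (hσ.axis_mem t)) hderiv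
  calc differential σ (axis t) w
      = differential σ (scaleTransversal 0 (axis t + w)) w := by rw [hzero]
    _ = ∑ j with j ≠ 0, (axis t + w : EuclideanSpace ℝ (Fin n)) j •
          E j ((axis t + w : EuclideanSpace ℝ (Fin n)) 0) :=
        hvel.symm.trans (eq_of_heq (Bundle.TotalSpace.mk.inj (hσ.initial _ hmem)).2)
    _ = ∑ j with j ≠ 0, w j • E j t := by
        rw [hstart]
        refine Finset.sum_congr rfl fun j hj => ?_
        simp [axis, (Finset.mem_filter.1 hj).2]

lemma differential_axis (he : IsParallelFrame h γ e) (t : ℝ) (j : Fin n) :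
    differential σ (axis t) (EuclideanSpace.single j 1) = e j t := by
  rcases eq_or_ne j 0 with rfl | hj
  · rw [hσ.differential_axis_single_zero, he.first]
  · obtain ⟨ε, hε, hmem⟩ := exists_add_smul_mem hσ.isOpen (hσ.axis_mem t)
      (EuclideanSpace.single j (1 : ℝ))
    refine smul_right_injective _ hε ?_
    calc ε • differential σ (axis t) (EuclideanSpace.single j 1)
        = ∑ k with k ≠ 0, (ε • EuclideanSpace.single j (1 : ℝ) : EuclideanSpace ℝ (Fin n)) k •
            (show EuclideanSpace ℝ (Fin n) from e k t) := by
          rw [← map_smul, hσ.differential_axis_of_add_mem (by simp [hj.symm]) hmem]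
      _ = ε • (show EuclideanSpace ℝ (Fin n) from e j t) := by
          rw [Finset.sum_eq_single_of_mem j (by simpa using hj)]
          · simp
          · rintro k - hk
            rw [PiLp.smul_apply, PiLp.single_apply, if_neg hk, smul_zero, zero_smul]

lemma metricComp_axis (he : IsParallelFrame h γ e) (t : ℝ) : metricComp h σ (axis t) = 1 := by
  obtain rfl := hσ.comp_axis
  ext i j
  calc metricComp h σ (axis t) i j = innerAt h (σ (axis t)) (e i t) (e j t) := by
        rw [← hσ.differential_axis he, ← hσ.differential_axis he]; rfl
    _ = innerAt h (σ (axis 0)) (e i 0) (e j 0) :=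
        innerAt_eq_of_isParallelOn (he.parallel i) (he.parallel j) hσ.mdifferentiable_curve t 0
    _ = (1 : Matrix (Fin n) (Fin n) ℝ) i j := (he.orthonormal i j).trans Matrix.one_apply.symm

lemma exists_isInverseChart_axis (he : IsParallelFrame h γ e) (t : ℝ) :
    ∃ χ, IsInverseChart χ σ ∧ axis t ∈ χ.target ∧ χ.target ⊆ U :=
  exists_isInverseChart hσ.isOpen hσ.smooth (hσ.axis_mem t) <|
    (metricComp_posDef_iff h).1 (by rw [hσ.metricComp_axis he]; exact .one)

lemma connection_axis_single_zero (he : IsParallelFrame h γ e) (t : ℝ) (k : Fin n) :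
    connection (metricComp h σ) (axis t) (EuclideanSpace.single 0 1)
      *ᵥ (EuclideanSpace.single k (1 : ℝ)).ofLp = 0 := by
  obtain ⟨χ, hχ, ht, -⟩ := hσ.exists_isInverseChart_axis he t
  obtain rfl := hσ.comp_axis
  exact hχ.connection_mulVec_eq_zero ht (hasDerivAt_axis t) (Set.mem_univ t) (he.parallel k)
    (.of_forall fun r => (hσ.differential_axis he r k).symm)

lemma connection_axis_mulVec_self (he : IsParallelFrame h γ e) (t : ℝ)
    {w : EuclideanSpace ℝ (Fin n)} (hw : w 0 = 0) :
    connection (metricComp h σ) (axis t) w *ᵥ w.ofLp = 0 := by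
  obtain ⟨χ, hχ, ht, hχU⟩ := hσ.exists_isInverseChart_axis he t
  obtain ⟨ε, hε, hmem⟩ := exists_add_smul_mem hσ.isOpen (hσ.axis_mem t) w
  have hderiv := hasDerivAt_add_smul (axis t) (ε • w)
  have hgeodesic := hσ.isGeodesicOn_axis_add_smul (w := ε • w) (by simp [hw]) hmem
  have ht' : axis t + (0 : ℝ) • ε • w ∈ χ.target := by simpa using ht
  have hvel : ∀ᶠ s : ℝ in 𝓝 0, velocity (fun s : ℝ => σ (axis t + s • ε • w)) s
      = differential σ (axis t + s • ε • w) (ε • w) := by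
    filter_upwards [(hderiv 0).continuousAt.preimage_mem_nhds (χ.open_target.mem_nhds ht')]
      with s hs
    exact velocity_comp (hσ.mdifferentiableAt (hχU hs)) (hderiv s)
  have hzero := hχ.connection_mulVec_eq_zero ht' (hderiv 0) (hχU ht') hgeodesic.2 hvel
  rw [zero_smul, add_zero, connection_smul, WithLp.ofLp_smul, Matrix.smul_mulVec,
    Matrix.mulVec_smul] at hzero
  simpa [hε] using hzero

lemma christoffel_axis (he : IsParallelFrame h γ e) (t : ℝ) (i j k : Fin n) :
    christoffel (metricComp h σ) i j k (axis t) = 0 := by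
  have hG := metricComp_isSymm h σ
  have hself {w : EuclideanSpace ℝ (Fin n)} (hw : w 0 = 0) :=
    hσ.connection_axis_mulVec_self he t hw
  have hconnection : connection (metricComp h σ) (axis t) (EuclideanSpace.single j 1)
      *ᵥ (EuclideanSpace.single k (1 : ℝ)).ofLp = 0 := by
    rcases eq_or_ne j 0 with rfl | hj
    · exact hσ.connection_axis_single_zero he t k
    rcases eq_or_ne k 0 with rfl | hk
    · rw [connection_mulVec_comm hG]
      exact hσ.connection_axis_single_zero he t j
    · exact connection_mulVec_eq_zero_of_self hG (hself (by simp [hj.symm]))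
        (hself (by simp [hk.symm])) (hself (by simp [hj.symm, hk.symm]))
  rw [← connection_single_mulVec_single, hconnection, Pi.zero_apply]

lemma isNormalAt_axis (he : IsParallelFrame h γ e) (t : ℝ) :
    IsNormalAt (metricComp h σ) (axis t) where
  isSymm := metricComp_isSymm h σ
  contDiffAt a b := (contDiffOn_metricComp h hσ.isOpen hσ.smooth a b).contDiffAt
    (hσ.isOpen.mem_nhds (hσ.axis_mem t))
  eq_one := hσ.metricComp_axis he t
  christoffel_eq_zero := hσ.christoffel_axis he t

lemma covDeriv_riemann_axis (he : IsParallelFrame h γ e) (hR : IsCurvatureParallelAlong h γ)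
    (t : ℝ) (a : Fin 3 → Fin n) (i : Fin n) :
    covDeriv (metricComp h σ) (riemann (metricComp h σ)) (axis t)
      (Fin.cons (α := fun _ : Fin 4 => Fin n) 0 a) i = 0 := by
  obtain ⟨χ, hχ, ht, -⟩ := hσ.exists_isInverseChart_axis he t
  obtain rfl := hσ.comp_axis
  have hvel (b : Fin n) : vecComp χ (σ (axis t)) (velocity (fun s => σ (axis s)) t) b
      = (EuclideanSpace.single 0 1 : EuclideanSpace ℝ (Fin n)) b := by
    rw [← hσ.differential_axis_single_zero]
    exact congrArg (· b) (hχ.chartDifferential_differential ht _)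
  have hcov := hR t χ hχ.mem_maximalAtlas (hχ.mem_source ht) a i
  rw [← covDeriv_riemann_congr (hχ.metricComp_eventuallyEq ht h)]
  simpa [hvel, hχ.right_inv ht, Pi.single_apply] using hcov

end IsGeodesicNormalCoordinates

end NormalCoordinates

end GeodesicCoords

theorem mainTheorem5_general {n : ℕ} [NeZero n] {N : Type*} [TopologicalSpace N]
    [ChartedSpace (EuclideanSpace ℝ (Fin n)) N] [IsManifold (𝓡 n) ∞ N]
    (h : GeodesicCoords.Metric n N) (γ : ℝ → N)
    (hR : GeodesicCoords.IsCurvatureParallelAlong h γ)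
    (e : Fin n → (t : ℝ) → TangentSpace (𝓡 n) (γ t))
    (he : GeodesicCoords.IsParallelFrame h γ e)
    (U : Set (EuclideanSpace ℝ (Fin n))) (σ : EuclideanSpace ℝ (Fin n) → N)
    (hσ : GeodesicCoords.IsGeodesicNormalCoordinates h γ e U σ)
    (Γ : Fin n → Fin n → Fin n → EuclideanSpace ℝ (Fin n) → ℝ)
    (hΓ : Γ = GeodesicCoords.christoffel (GeodesicCoords.metricComp h σ)) :
    (∀ (t : ℝ) (i j k : Fin n), ContDiffAt ℝ ∞ (Γ i j k) (GeodesicCoords.axis t)) ∧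
    ∀ (q : ℕ) (t : ℝ),
      (∀ i j k : Fin n, (GeodesicCoords.pd 0)^[q]
        (GeodesicCoords.pd 0 (GeodesicCoords.pd j (Γ i 0 k))) (GeodesicCoords.axis t) = 0) ∧
      (∀ i k : Fin n, (GeodesicCoords.pd 0)^[q]
        (GeodesicCoords.pd 0 (Γ i 0 k)) (GeodesicCoords.axis t) = 0) ∧
      (GeodesicCoords.pd 0)^[q] (Γ 0 0 0) (GeodesicCoords.axis t) = 0 ∧
      (∀ k : Fin n, (GeodesicCoords.pd 0)^[q]
        (GeodesicCoords.pd k (Γ 0 0 0)) (GeodesicCoords.axis t) = 0) ∧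
      (∀ j k : Fin n, (GeodesicCoords.pd 0)^[q]
        (GeodesicCoords.pd j (GeodesicCoords.pd k (Γ 0 0 0))) (GeodesicCoords.axis t) = 0) := by
  subst hΓ
  have hG := hσ.isNormalAt_axis he
  have hcov := hσ.covDeriv_riemann_axis he hR
  have hsmooth (t : ℝ) (i j k : Fin n) := (hG t).contDiffAt_christoffel i j k
  have hpd {f : EuclideanSpace ℝ (Fin n) → ℝ} {x : EuclideanSpace ℝ (Fin n)}
      (hf : ContDiffAt ℝ ∞ f x) (i : Fin n) : ContDiffAt ℝ ∞ (GeodesicCoords.pd i f) x :=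
    GeodesicCoords.contDiffAt_pd hf (by simp) i
  refine ⟨hsmooth, fun q t => ⟨fun i j k => ?_, fun i k => ?_, ?_, fun k => ?_, fun j k => ?_⟩⟩ <;>
    refine GeodesicCoords.iterate_pd_zero_axis_eq_zero (fun s => ?_) (fun s => ?_) q t
  · exact GeodesicCoords.pd_zero_pd_christoffel_axis hG (hcov s) i j k
  · exact hpd (hpd (hsmooth s i 0 k) j) 0
  · exact GeodesicCoords.pd_zero_christoffel_axis hG i 0 k s
  · exact hpd (hsmooth s i 0 k) 0
  · exact (hG s).christoffel_eq_zero 0 0 0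
  · exact hsmooth s 0 0 0
  · exact GeodesicCoords.pd_christoffel_zero_zero_zero_axis hG k s
  · exact hpd (hsmooth s 0 0 0) k
  · exact GeodesicCoords.pd_pd_christoffel_zero_zero_zero_axis hG (hcov s) j k
  · exact hpd (hpd (hsmooth s 0 0 0) k) j

theorem mainTheorem5 {n : ℕ} [NeZero n] {N : Type*} [TopologicalSpace N]
    [ChartedSpace (EuclideanSpace ℝ (Fin n)) N] [IsManifold (𝓡 n) ∞ N]
    (h : GeodesicCoords.Metric n N) (γ : ℝ → N)
    (hγ : GeodesicCoords.IsGeodesicOn h γ Set.univ)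
    (hsymm : GeodesicCoords.IsLocallySymmetricAlong h γ)
    (e : Fin n → (t : ℝ) → TangentSpace (𝓡 n) (γ t))
    (he : GeodesicCoords.IsParallelFrame h γ e)
    (U : Set (EuclideanSpace ℝ (Fin n))) (σ : EuclideanSpace ℝ (Fin n) → N)
    (hσ : GeodesicCoords.IsGeodesicNormalCoordinates h γ e U σ)
    (Γ : Fin n → Fin n → Fin n → EuclideanSpace ℝ (Fin n) → ℝ)
    (hΓ : Γ = GeodesicCoords.christoffel (GeodesicCoords.metricComp h σ)) :
    (∀ (t : ℝ) (i j k : Fin n), ContDiffAt ℝ ∞ (Γ i j k) (GeodesicCoords.axis t)) ∧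
    ∀ (q : ℕ) (t : ℝ),
      (∀ i j k : Fin n, (GeodesicCoords.pd 0)^[q]
        (GeodesicCoords.pd 0 (GeodesicCoords.pd j (Γ i 0 k))) (GeodesicCoords.axis t) = 0) ∧
      (∀ i k : Fin n, (GeodesicCoords.pd 0)^[q]
        (GeodesicCoords.pd 0 (Γ i 0 k)) (GeodesicCoords.axis t) = 0) ∧
      (GeodesicCoords.pd 0)^[q] (Γ 0 0 0) (GeodesicCoords.axis t) = 0 ∧
      (∀ k : Fin n, (GeodesicCoords.pd 0)^[q]
        (GeodesicCoords.pd k (Γ 0 0 0)) (GeodesicCoords.axis t) = 0) ∧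
      (∀ j k : Fin n, (GeodesicCoords.pd 0)^[q]
        (GeodesicCoords.pd j (GeodesicCoords.pd k (Γ 0 0 0))) (GeodesicCoords.axis t) = 0) :=
  mainTheorem5_general h γ (hsymm 0) e he U σ hσ Γ hΓ
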